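/- Let $N\ge 1$, let $\mathfrak F:\mathbb R^{I_1\times\cdots\times I_N}\to\mathbb R^m$ be a linear operator, and let $r_1,\dots,r_N$ be nonnegative integers. For a tensor $\mathcal X\in\mathbb R^{I_1\times\cdots\times I_N}$ let $X_{(i)}\in\mathbb R^{I_i\times\prod_{k\ne i}I_k}$ be its mode-$i$ unfolding (the matrix whose columns are the mode-$i$ fibers of $\mathcal X$), let $\sigma_1(X_{(i)})\ge\sigma_2(X_{(i)})\ge\cdots\ge0$ be the singular values of $X_{(i)}$ (with $\sigma_j=0$ for $j$ beyond the number of singular values), let $\|X_{(i)}\|_*$ be their sum, and let $\|\mathcal X\|_*=\frac1N\sum_{i=1}^N\|X_{(i)}\|_*$. Suppose that every nonzero $\mathcal H\in\mathbb R^{I_1\times\cdots\times I_N}$ with $\mathfrak F(\mathcal H)=0$ satisfies $$\sum_{i=1}^N\sum_{j=r_i+1}^{I_i}\sigma_j(H_{(i)})>\sum_{i=1}^N\sum_{j=1}^{r_i}\sigma_j(H_{(i)}).$$ Then, for every tensor $\mathcal X^0$ with $\operatorname{rank}X^0_{(i)}\le r_i$ for $i=1,\dots,N$ and $b=\mathfrak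 F(\mathcal X^0)$, the problem $$\min_{\mathcal X}\{\|\mathcal X\|_*:\mathfrak F(\mathcal X)=b\}$$ has $\mathcal X^0$ as its unique solution. -/

import Mathlib

open scoped BigOperators

noncomputable section

/-- Real tensors of order `N` and size `I 0 × ⋯ × I (N - 1)`. -/
abbrev Tensor {N : ℕ} (I : Fin N → ℕ) : Type := (∀ k, Fin (I k)) → ℝ

/-- The mode-`n` unfolding of a tensor of order `N = M + 1`: the matrix whose columns are the
mode-`n` fibers. `finPiFinEquiv` numbers the columns by the mixed-radix rule
`j = ∑_{k ≠ n} i_k * ∏_{m < k, m ≠ n} I_m` (indices starting at `0`). -/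
def Tensor.unfold {M : ℕ} {I : Fin (M + 1) → ℕ} (n : Fin (M + 1)) (X : Tensor I) :
    Matrix (Fin (I n)) (Fin (∏ k : Fin M, I (n.succAbove k))) ℝ :=
  Matrix.of fun a j => X (n.insertNth a (finPiFinEquiv.symm j))

/-- The `n`-rank: the column rank of the mode-`n` unfolding. -/
def Tensor.modeRank {M : ℕ} {I : Fin (M + 1) → ℕ} (n : Fin (M + 1)) (X : Tensor I) : ℕ :=
  (X.unfold n).rank

/-- The singular values of a real matrix in decreasing order, with multiplicity. The index starts
at `0`, so that `singularValue A j` is the `(j + 1)`-st largest singular value; it is `0` for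
`j ≥ min p q`. -/
def singularValue {p q : ℕ} (A : Matrix (Fin p) (Fin q) ℝ) (j : ℕ) : ℝ :=
  (Matrix.toEuclideanLin A).singularValues j

/-- The trace (nuclear) norm of a matrix: the sum of its singular values. -/
def matrixTraceNorm {p q : ℕ} (A : Matrix (Fin p) (Fin q) ℝ) : ℝ :=
  ∑ j ∈ Finset.range (min p q), singularValue A j

/-- The tensor trace norm: the average of the trace norms of the unfoldings in all
`N = M + 1` modes. -/
def Tensor.traceNorm {M : ℕ} {I : Fin (M + 1) → ℕ} (X : Tensor I) : ℝ :=
  (1 / ((M + 1 : ℕ) : ℝ)) * ∑ i : Fin (M + 1), matrixTraceNorm (X.unfold i)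

/-- `X` solves the problem of minimizing the tensor trace norm subject to `F X = b`. -/
def IsTraceNormMinimizer {M m : ℕ} {I : Fin (M + 1) → ℕ} (F : Tensor I →ₗ[ℝ] (Fin m → ℝ))
    (b : Fin m → ℝ) (X : Tensor I) : Prop :=
  F X = b ∧ ∀ Y : Tensor I, F Y = b → X.traceNorm ≤ Y.traceNorm

end

/-! For a competitor `Y ≠ X₀`, the tensor `H = X₀ - Y` is a nonzero element of the kernel. If in
each mode ‖A‖_* + ∑_{j≥r} σ_j(H) ≤ ‖A - H‖_* + ∑_{j<r} σ_j(H) whenever rank A ≤ r, then summing over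
the modes and using the strict null space condition gives `X₀` the strictly smaller norm.

The matrix inequality is an eigenvalue count. Let D_T be the self-adjoint dilation of T, with
nonzero eigenvalues ±σ_j(T), and let C be the positive part of D_{A-H}. Then D_H + C has trace ‖A -
H‖_* and dominates both D_H and D_A = D_H + D_{A-H}. By Courant–Fischer each of its eigenvalues may
be bounded below through whichever of D_A and D_H is better; adding these bounds gives the claim. -/

open Module InnerProductSpace

/-! ### Singular value decomposition and Courant–Fischer bounds -/

/-- The singular value decomposition, with as many terms as the rank. -/
theorem LinearMap.exists_orthonormal_apply_eq_sum_singularValues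
    {E F : Type*} [NormedAddCommGroup E] [InnerProductSpace ℝ E] [FiniteDimensional ℝ E]
    [NormedAddCommGroup F] [InnerProductSpace ℝ F] [FiniteDimensional ℝ F] (T : E →ₗ[ℝ] F) :
    ∃ (v : Fin (finrank ℝ T.range) → E) (u : Fin (finrank ℝ T.range) → F),
      Orthonormal ℝ v ∧ Orthonormal ℝ u ∧
        ∀ x, T x = ∑ k : Fin (finrank ℝ T.range), (T.singularValues k * inner ℝ (v k) x) • u k := by
  have hle : finrank ℝ T.range ≤ finrank ℝ E := T.finrank_range_le
  set b := T.isSymmetric_adjoint_comp_self.eigenvectorBasis rfl with hb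
  have hin : ∀ i j, inner ℝ (T (b i)) (T (b j)) =
      if i = j then T.singularValues i ^ 2 else 0 := by
    intro i j
    rw [← LinearMap.adjoint_inner_right, ← LinearMap.comp_apply, hb,
      T.isSymmetric_adjoint_comp_self.apply_eigenvectorBasis, ← hb, inner_smul_right,
      ← T.sq_singularValues_fin rfl j, orthonormal_iff_ite.mp b.orthonormal i j]
    split_ifs with h <;> simp [h]
  have hpos : ∀ k : Fin (finrank ℝ T.range), 0 < T.singularValues k := fun k =>
    T.singularValues_pos_iff_lt_finrank_range.mpr k.2
  refine ⟨fun k => b (Fin.castLE hle k), fun k => (T.singularValues k)⁻¹ • T (b (Fin.castLE hle k)),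
    b.orthonormal.comp _ (Fin.castLE_injective hle), ?_, fun x => ?_⟩
  · rw [orthonormal_iff_ite]
    intro i j
    rw [inner_smul_left, inner_smul_right, hin]
    by_cases h : i = j
    · subst h
      have := (hpos i).ne'
      simp
      field_simp
    · simp [h]
  · have hx : T x = ∑ i, inner ℝ (b i) x • T (b i) := by
      conv_lhs => rw [← b.sum_repr' x]
      simp
    rw [hx]
    symm
    -- The eigenvectors of T†T beyond the rank are killed by `T`, since ‖T b_i‖ = σ_i = 0.
    refine Finset.sum_of_injOn (Fin.castLE hle : Fin (finrank ℝ T.range) → _) (Fin.castLE_injective hle).injOn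
      (by simp) (fun i _ hi => ?_) (fun k _ => ?_)
    · have h0 : T.singularValues i = 0 := by
        rw [T.singularValues_eq_zero_iff_le_finrank_range]
        by_contra! h
        exact hi ⟨⟨i, h⟩, by simp, rfl⟩
      have : T (b i) = 0 := by
        rw [← inner_self_eq_zero (𝕜 := ℝ), hin]
        simp [h0]
      simp [this]
    · rw [smul_smul]
      have := (hpos k).ne'
      congr 1
      field_simp

/-- The Courant–Fischer lower bound for the eigenvalues of a symmetric operator. -/
theorem LinearMap.IsSymmetric.le_eigenvalues_of_forall_mem {E : Type*} [NormedAddCommGroup E]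
    [InnerProductSpace ℝ E] [FiniteDimensional ℝ E] {n : ℕ} {M : E →ₗ[ℝ] E}
    (hM : M.IsSymmetric) (hn : finrank ℝ E = n) (i : Fin n) {c : ℝ} {S : Submodule ℝ E}
    (hS : (i : ℕ) + 1 ≤ finrank ℝ S) (hc : ∀ z ∈ S, c * ‖z‖ ^ 2 ≤ inner ℝ z (M z)) :
    c ≤ hM.eigenvalues hn i := by
  set b := hM.eigenvectorBasis hn with hb
  set f : S →ₗ[ℝ] (Fin i → ℝ) :=
    LinearMap.pi fun k => (innerₛₗ ℝ (b (Fin.castLE i.2.le k))).comp S.subtype with hf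
  -- Only `i` linear conditions are imposed on a space of dimension at least `i + 1`, so some
  -- nonzero `z ∈ S` is orthogonal to the first `i` eigenvectors.
  obtain ⟨⟨z, hzS⟩, hz, hz0⟩ := Submodule.exists_mem_ne_zero_of_ne_bot
    (LinearMap.ker_ne_bot_of_finrank_lt (f := f) (by simpa using hS))
  have hz0' : z ≠ 0 := fun h => hz0 (by simp [h])
  have hzk : ∀ k : Fin n, k < i → inner ℝ (b k) z = 0 := by
    intro k hk
    have := congrFun (LinearMap.mem_ker.mp hz) ⟨k, hk⟩
    simpa [hf] using this
  have hup : inner ℝ z (M z) ≤ hM.eigenvalues hn i * ‖z‖ ^ 2 := by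
    rw [← b.sum_inner_mul_inner, ← b.sum_sq_inner_right, Finset.mul_sum]
    refine Finset.sum_le_sum fun k _ => ?_
    rw [← hM, hb, hM.apply_eigenvectorBasis, ← hb, real_inner_comm, RCLike.ofReal_real_eq_id, id_eq,
      inner_smul_left]
    by_cases hk : k < i
    · simp [hzk k hk]
    · have := hM.eigenvalues_antitone hn (not_lt.mp hk)
      simp only [conj_trivial]
      nlinarith [mul_le_mul_of_nonneg_right this (sq_nonneg (inner ℝ (b k) z))]
  exact le_of_mul_le_mul_right ((hc z hzS).trans hup) (by positivity)

/-- The test subspaces for different `i` need not be nested or related, so the bounds may come from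
different operators below `M`. -/
theorem LinearMap.IsSymmetric.sum_le_trace_of_forall_exists_submodule {E : Type*}
    [NormedAddCommGroup E] [InnerProductSpace ℝ E] [FiniteDimensional ℝ E] {M : E →ₗ[ℝ] E}
    (hM : M.IsSymmetric) (f : ℕ → ℝ)
    (hf : ∀ i < finrank ℝ E, ∃ S : Submodule ℝ E, i + 1 ≤ finrank ℝ S ∧
      ∀ z ∈ S, f i * ‖z‖ ^ 2 ≤ inner ℝ z (M z)) :
    ∑ i ∈ Finset.range (finrank ℝ E), f i ≤ LinearMap.trace ℝ E M := by
  have := hM.trace_eq_sum_eigenvalues rfl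
  rw [this, Finset.sum_range]
  simp only [RCLike.ofReal_real_eq_id]
  refine Finset.sum_le_sum fun i _ => ?_
  obtain ⟨S, hS, h⟩ := hf i i.2
  exact hM.le_eigenvalues_of_forall_mem rfl i hS h

/-! ### Self-adjoint dilations and the Mirsky-type inequality -/

section Dilation

variable {E F : Type*} [NormedAddCommGroup E] [InnerProductSpace ℝ E] [FiniteDimensional ℝ E]
  [NormedAddCommGroup F] [InnerProductSpace ℝ F] [FiniteDimensional ℝ F] (T : E →ₗ[ℝ] F)

theorem finrank_withLp_prod :
    finrank ℝ (WithLp 2 (F × E)) = finrank ℝ F + finrank ℝ E := by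
  rw [(WithLp.linearEquiv 2 ℝ (F × E)).finrank_eq, finrank_prod]

/-- The self-adjoint dilation `(y, x) ↦ (T x, T† y)` of `T`, described by its quadratic form. -/
theorem LinearMap.exists_isSymmetric_dilation :
    ∃ D : WithLp 2 (F × E) →ₗ[ℝ] WithLp 2 (F × E), D.IsSymmetric ∧
      LinearMap.trace ℝ _ D = 0 ∧ ∀ z, inner ℝ z (D z) = 2 * inner ℝ z.fst (T z.snd) := by
  obtain ⟨v, u, hv, hu, hT⟩ := T.exists_orthonormal_apply_eq_sum_singularValues
  -- (u_k, ±v_k) are the eigenvectors for ±σ_k. Their squared norm is 2, whence the factor 1/2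
  -- below; their equal norms make the trace vanish.
  set w : Fin (finrank ℝ T.range) → WithLp 2 (F × E) := fun k => WithLp.toLp 2 (u k, v k) with hw
  set w' : Fin (finrank ℝ T.range) → WithLp 2 (F × E) := fun k => WithLp.toLp 2 (u k, -v k) with hw'
  refine ⟨∑ k : Fin (finrank ℝ T.range), (T.singularValues k / 2) •
    ((rankOne ℝ (w k) (w k)).toLinearMap - (rankOne ℝ (w' k) (w' k)).toLinearMap), ?_, ?_, ?_⟩
  · intro x y
    simp only [LinearMap.sum_apply, LinearMap.smul_apply, LinearMap.sub_apply, sum_inner,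
      inner_sum, inner_smul_left, inner_smul_right, inner_sub_left, inner_sub_right,
      (isSymmetric_rankOne_self (𝕜 := ℝ) _) x y, conj_trivial]
  · rw [map_sum]
    refine Finset.sum_eq_zero fun k _ => ?_
    rw [map_smul, map_sub, trace_rankOne, trace_rankOne]
    rw [real_inner_self_eq_norm_sq, real_inner_self_eq_norm_sq, WithLp.prod_norm_sq_eq_of_L2,
      WithLp.prod_norm_sq_eq_of_L2]
    simp [hw, hw']
  · intro z
    rw [hT, inner_sum, Finset.mul_sum, LinearMap.sum_apply, inner_sum]
    refine Finset.sum_congr rfl fun k _ => ?_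
    simp [hw, hw', inner_smul_right, inner_sub_right, real_inner_comm]
    ring

/-- The positive part of the self-adjoint dilation of `T` has the sum of the singular values of
`T` as its trace. -/
theorem LinearMap.exists_isSymmetric_ge_dilation {m : ℕ} (hm : finrank ℝ T.range ≤ m) :
    ∃ C : WithLp 2 (F × E) →ₗ[ℝ] WithLp 2 (F × E), C.IsSymmetric ∧
      LinearMap.trace ℝ _ C = ∑ j ∈ Finset.range m, T.singularValues j ∧
      (∀ z, 0 ≤ inner ℝ z (C z)) ∧ ∀ z, 2 * inner ℝ z.fst (T z.snd) ≤ inner ℝ z (C z) := by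
  obtain ⟨v, u, hv, hu, hT⟩ := T.exists_orthonormal_apply_eq_sum_singularValues
  set w : Fin (finrank ℝ T.range) → WithLp 2 (F × E) := fun k => WithLp.toLp 2 (u k, v k) with hw
  have hC : ∀ z, inner ℝ z ((∑ k : Fin (finrank ℝ T.range), (T.singularValues k / 2) •
      (rankOne ℝ (w k) (w k)).toLinearMap) z) = ∑ k : Fin (finrank ℝ T.range),
        T.singularValues k / 2 * (inner ℝ (u k) z.fst + inner ℝ (v k) z.snd) ^ 2 := by
    intro z
    rw [LinearMap.sum_apply, inner_sum]
    refine Finset.sum_congr rfl fun k _ => ?_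
    rw [LinearMap.smul_apply, inner_smul_right, ContinuousLinearMap.coe_coe, rankOne_apply,
      inner_smul_right, real_inner_comm (w k) z, hw, WithLp.prod_inner_apply]
    simp only [WithLp.ofLp_fst, WithLp.ofLp_snd]
    ring
  refine ⟨∑ k : Fin (finrank ℝ T.range), (T.singularValues k / 2) •
    (rankOne ℝ (w k) (w k)).toLinearMap, ?_, ?_, ?_, ?_⟩
  · intro x y
    simp only [LinearMap.sum_apply, LinearMap.smul_apply, sum_inner,
      inner_sum, inner_smul_left, inner_smul_right,
      (isSymmetric_rankOne_self (𝕜 := ℝ) _) x y, conj_trivial]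
  · rw [← Finset.sum_subset (Finset.range_mono hm) (fun j _ hj =>
      T.singularValues_eq_zero_iff_le_finrank_range.mpr (by simpa using hj)), Finset.sum_range]
    rw [map_sum]
    refine Finset.sum_congr rfl fun k _ => ?_
    rw [map_smul, trace_rankOne, hw, WithLp.prod_inner_apply]
    simp [hv.1 k, hu.1 k]
    ring
  · intro z
    rw [hC]
    exact Finset.sum_nonneg fun k _ =>
      mul_nonneg (div_nonneg (T.singularValues_nonneg k) two_pos.le) (sq_nonneg _)
  · intro z
    rw [hC, hT, inner_sum, Finset.mul_sum]
    refine Finset.sum_le_sum fun k _ => ?_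
    rw [inner_smul_right, real_inner_comm (u k)]
    -- The gap is the discarded negative part, σ_k/2 · (⟨u_k, y⟩ - ⟨v_k, x⟩)².
    nlinarith [mul_nonneg (T.singularValues_nonneg k)
      (sq_nonneg (inner ℝ (u k) z.fst - inner ℝ (v k) z.snd))]

/-- Imposing orthogonality to the vectors (u_k, -v_k) with k < j removes the most negative
eigenvalues of the dilation, at a cost of at most `j` dimensions. -/
theorem LinearMap.exists_submodule_neg_singularValue_le (j : ℕ) :
    ∃ S : Submodule ℝ (WithLp 2 (F × E)), finrank ℝ F + finrank ℝ E ≤ finrank ℝ S + j ∧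
      ∀ z ∈ S, -T.singularValues j * ‖z‖ ^ 2 ≤ 2 * inner ℝ z.fst (T z.snd) := by
  obtain ⟨v, u, hv, hu, hT⟩ := T.exists_orthonormal_apply_eq_sum_singularValues
  set f : WithLp 2 (F × E) →ₗ[ℝ] ({k : Fin (finrank ℝ T.range) // (k : ℕ) < j} → ℝ) :=
    LinearMap.pi fun k => innerₛₗ ℝ (WithLp.toLp 2 (u k, -v k)) with hf
  refine ⟨LinearMap.ker f, ?_, fun z hz => ?_⟩
  · have h1 := f.finrank_range_add_finrank_ker
    rw [finrank_withLp_prod] at h1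
    have h2 : finrank ℝ (LinearMap.range f) ≤ j := by
      refine (Submodule.finrank_le _).trans ?_
      rw [finrank_fintype_fun_eq_card]
      simpa using Fintype.card_le_of_injective
        (fun k : {k : Fin (finrank ℝ T.range) // (k : ℕ) < j} => (⟨k.1, k.2⟩ : Fin j))
        (fun a b h => by simpa [Subtype.ext_iff, Fin.ext_iff] using h)
    omega
  · have hzk : ∀ k : Fin (finrank ℝ T.range), (k : ℕ) < j →
        inner ℝ (u k) z.fst = inner ℝ (v k) z.snd := by
      intro k hk
      have := congrFun (LinearMap.mem_ker.mp hz) ⟨k, hk⟩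
      simp [hf] at this
      linarith
    have hbu := hu.sum_inner_products_le z.fst (s := Finset.univ)
    have hbv := hv.sum_inner_products_le z.snd (s := Finset.univ)
    simp only [Real.norm_eq_abs, sq_abs] at hbu hbv
    have hj := T.singularValues_nonneg j
    calc -T.singularValues j * ‖z‖ ^ 2
        ≤ -T.singularValues j * ∑ k, (inner ℝ (u k) z.fst ^ 2 + inner ℝ (v k) z.snd ^ 2) := by
          rw [WithLp.prod_norm_sq_eq_of_L2, Finset.sum_add_distrib]
          -- Bessel's inequality, reversed by the factor -σ_j ≤ 0.
          nlinarith [mul_le_mul_of_nonneg_left (add_le_add hbu hbv) hj]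
      _ ≤ 2 * inner ℝ z.fst (T z.snd) := by
          rw [hT, inner_sum, Finset.mul_sum, Finset.mul_sum]
          refine Finset.sum_le_sum fun k _ => ?_
          rw [inner_smul_right, real_inner_comm (u k)]
          have hk0 := T.singularValues_nonneg k
          by_cases hk : (k : ℕ) < j
          · rw [hzk k hk]
            nlinarith [mul_nonneg (add_nonneg hk0 hj) (sq_nonneg (inner ℝ (v k) z.snd))]
          · have hkj := T.singularValues_antitone (not_lt.mp hk)
            nlinarith [mul_nonneg hk0
              (sq_nonneg (inner ℝ (u k) z.fst + inner ℝ (v k) z.snd)),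
              mul_nonneg (sub_nonneg.mpr hkj)
              (add_nonneg (sq_nonneg (inner ℝ (u k) z.fst)) (sq_nonneg (inner ℝ (v k) z.snd)))]

theorem LinearMap.exists_submodule_nonneg_of_finrank_range_le {r : ℕ}
    (hr : finrank ℝ T.range ≤ r) :
    ∃ S : Submodule ℝ (WithLp 2 (F × E)), finrank ℝ F + finrank ℝ E ≤ finrank ℝ S + r ∧
      ∀ z ∈ S, 0 ≤ 2 * inner ℝ z.fst (T z.snd) := by
  obtain ⟨S, hS, h⟩ := T.exists_submodule_neg_singularValue_le r
  refine ⟨S, hS, fun z hz => ?_⟩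
  simpa [T.singularValues_eq_zero_iff_le_finrank_range.mpr hr] using h z hz

/-- Below the rank, the span of the (u_k, v_k) with k ≤ i works. Otherwise σ_i = 0, and the subspace
where the form is nonnegative is large enough. -/
theorem LinearMap.exists_submodule_singularValue_le {i : ℕ}
    (hi : i < min (finrank ℝ F) (finrank ℝ E)) :
    ∃ S : Submodule ℝ (WithLp 2 (F × E)), i + 1 ≤ finrank ℝ S ∧
      ∀ z ∈ S, T.singularValues i * ‖z‖ ^ 2 ≤ 2 * inner ℝ z.fst (T z.snd) := by
  by_cases hir : i < finrank ℝ T.range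
  swap
  · obtain ⟨S, hS, h⟩ := T.exists_submodule_nonneg_of_finrank_range_le (not_lt.mp hir)
    refine ⟨S, by omega, fun z hz => ?_⟩
    simpa [T.singularValues_eq_zero_iff_le_finrank_range.mpr (not_lt.mp hir)] using h z hz
  obtain ⟨v, u, hv, hu, hT⟩ := T.exists_orthonormal_apply_eq_sum_singularValues
  set ι : Fin (i + 1) → Fin (finrank ℝ T.range) := Fin.castLE hir with hι
  have hιinj : Function.Injective ι := Fin.castLE_injective hir
  have hvι := hv.comp ι hιinj
  have huι := hu.comp ι hιinj
  set w : Fin (i + 1) → WithLp 2 (F × E) := fun k => WithLp.toLp 2 (u (ι k), v (ι k)) with hw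
  have hwi : LinearIndependent ℝ w :=
    LinearIndependent.of_comp (WithLp.sndL 2 ℝ F E).toLinearMap hvι.linearIndependent
  refine ⟨Submodule.span ℝ (Set.range w), ?_, fun z hz => ?_⟩
  · rw [finrank_span_eq_card hwi, Fintype.card_fin]
  · obtain ⟨c, rfl⟩ := (Submodule.mem_span_range_iff_exists_fun ℝ).mp hz
    have h1 : (∑ k, c k • w k).fst = ∑ k, c k • (u ∘ ι) k := by
      exact map_sum (WithLp.fstL 2 ℝ F E) (fun k => c k • w k) Finset.univ
    have h2 : (∑ k, c k • w k).snd = ∑ k, c k • (v ∘ ι) k := by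
      exact map_sum (WithLp.sndL 2 ℝ F E) (fun k => c k • w k) Finset.univ
    have hTv : ∀ l, T (v l) = T.singularValues l • u l := by
      intro l
      rw [hT, Finset.sum_eq_single l]
      · simp [hv.1 l]
      · intro k _ hk
        simp [hv.2 hk]
      · simp
    have h3 : T (∑ k, c k • (v ∘ ι) k) = ∑ k, (c k * T.singularValues k) • (u ∘ ι) k := by
      rw [map_sum]
      refine Finset.sum_congr rfl fun k _ => ?_
      simp [hTv, smul_smul, hι]
    rw [WithLp.prod_norm_sq_eq_of_L2, h1, h2, h3, ← real_inner_self_eq_norm_sq,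
      ← real_inner_self_eq_norm_sq, huι.inner_sum, huι.inner_sum, hvι.inner_sum, ← two_mul,
      mul_left_comm, Finset.mul_sum]
    refine mul_le_mul_of_nonneg_left (Finset.sum_le_sum fun k _ => ?_) two_pos.le
    have := T.singularValues_antitone (Nat.lt_succ_iff.mp k.2)
    simp only [conj_trivial]
    nlinarith [mul_le_mul_of_nonneg_left this (mul_self_nonneg (c k))]

/-- A special case of Mirsky's inequality `∑ j, |σ_j(A) - σ_j(H)| ≤ ‖A - H‖_*`. -/
theorem LinearMap.sum_singularValues_add_le_of_finrank_range_le (A H : E →ₗ[ℝ] F) {m r : ℕ}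
    (hm : m = min (finrank ℝ F) (finrank ℝ E)) (hA : finrank ℝ A.range ≤ r) (hr : r ≤ m) :
    ∑ j ∈ Finset.range m, A.singularValues j + ∑ j ∈ Finset.Ico r m, H.singularValues j ≤
      ∑ j ∈ Finset.range m, (A - H).singularValues j
        + ∑ j ∈ Finset.range r, H.singularValues j := by
  have hB : finrank ℝ (A - H).range ≤ m := by
    have h1 := (A - H).finrank_range_le
    have h2 := (A - H).range.finrank_le
    omega
  obtain ⟨D, hD, hDt, hDz⟩ := H.exists_isSymmetric_dilation
  obtain ⟨C, hC, hCt, hC0, hCz⟩ := (A - H).exists_isSymmetric_ge_dilation hB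
  have hHM : ∀ z, 2 * inner ℝ z.fst (H z.snd) ≤ inner ℝ z ((D + C) z) := fun z => by
    rw [LinearMap.add_apply, inner_add_right, hDz]
    linarith [hC0 z]
  have hAM : ∀ z, 2 * inner ℝ z.fst (A z.snd) ≤ inner ℝ z ((D + C) z) := fun z => by
    have := hCz z
    rw [LinearMap.sub_apply, inner_sub_right] at this
    rw [LinearMap.add_apply, inner_add_right, hDz]
    linarith
  set n := finrank ℝ F + finrank ℝ E with hn
  -- The top `r` eigenvalues are compared with D_A and those up to `m` with D_H. The middle ones are
  -- nonnegative because D_A has at most `r` negative eigenvalues, and the last `r` are compared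
  -- with the bottom of D_H. The ranges fit since r ≤ m and 2m ≤ n.
  have key := (hD.add hC).sum_le_trace_of_forall_exists_submodule
    (fun i => if i < r then A.singularValues i else if i < m then H.singularValues i else
      if i < n - r then 0 else -H.singularValues (n - 1 - i)) (by
    rw [finrank_withLp_prod]
    intro i hi
    split_ifs with h1 h2 h3
    · obtain ⟨S, hS, h⟩ := A.exists_submodule_singularValue_le (i := i) (by omega)
      exact ⟨S, hS, fun z hz => (h z hz).trans (hAM z)⟩
    · obtain ⟨S, hS, h⟩ := H.exists_submodule_singularValue_le (i := i) (by omega)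
      exact ⟨S, hS, fun z hz => (h z hz).trans (hHM z)⟩
    · obtain ⟨S, hS, h⟩ := A.exists_submodule_nonneg_of_finrank_range_le hA
      exact ⟨S, by omega, fun z hz => by simpa using (h z hz).trans (hAM z)⟩
    · obtain ⟨S, hS, h⟩ := H.exists_submodule_neg_singularValue_le (n - 1 - i)
      exact ⟨S, by omega, fun z hz => (h z hz).trans (hHM z)⟩)
  rw [map_add, hDt, hCt, zero_add, finrank_withLp_prod, ← hn,
    ← Finset.sum_range_add_sum_Ico _ (show r ≤ n by omega),
    ← Finset.sum_Ico_consecutive _ hr (show m ≤ n by omega),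
    ← Finset.sum_Ico_consecutive _ (show m ≤ n - r by omega) (Nat.sub_le n r)] at key
  have e1 : ∑ i ∈ Finset.range m, A.singularValues i = ∑ i ∈ Finset.range r,
      (if i < r then A.singularValues i else if i < m then H.singularValues i else
      if i < n - r then 0 else -H.singularValues (n - 1 - i)) := by
    rw [← Finset.sum_subset (Finset.range_mono hr) (fun j _ hj =>
      A.singularValues_eq_zero_iff_le_finrank_range.mpr
        (hA.trans (by simpa using hj)))]
    exact Finset.sum_congr rfl fun i hi => by rw [if_pos (Finset.mem_range.mp hi)]
  have e2 : ∑ i ∈ Finset.Ico r m, H.singularValues i = ∑ i ∈ Finset.Ico r m,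
      (if i < r then A.singularValues i else if i < m then H.singularValues i else
      if i < n - r then 0 else -H.singularValues (n - 1 - i)) := by
    refine Finset.sum_congr rfl fun i hi => ?_
    rw [Finset.mem_Ico] at hi
    rw [if_neg (by omega), if_pos hi.2]
  have e3 : 0 = ∑ i ∈ Finset.Ico m (n - r),
      (if i < r then A.singularValues i else if i < m then H.singularValues i else
      if i < n - r then 0 else -H.singularValues (n - 1 - i)) := by
    symm
    refine Finset.sum_eq_zero fun i hi => ?_
    rw [Finset.mem_Ico] at hi
    rw [if_neg (by omega), if_neg (by omega), if_pos hi.2]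
  have e4 : -∑ i ∈ Finset.range r, H.singularValues i = ∑ i ∈ Finset.Ico (n - r) n,
      (if i < r then A.singularValues i else if i < m then H.singularValues i else
      if i < n - r then 0 else -H.singularValues (n - 1 - i)) := by
    rw [← Finset.sum_neg_distrib, ← Finset.sum_range_reflect, Finset.sum_Ico_eq_sum_range,
      show n - (n - r) = r by omega]
    refine Finset.sum_congr rfl fun i hi => ?_
    rw [Finset.mem_range] at hi
    rw [if_neg (by omega), if_neg (by omega), if_neg (by omega)]
    congr 2
    omega
  linarith

end Dilation

/-! ### Transfer to matrices and tensor unfoldings -/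

theorem finrank_range_toEuclideanLin {p q : ℕ} (A : Matrix (Fin p) (Fin q) ℝ) :
    finrank ℝ (Matrix.toEuclideanLin A).range = A.rank := by
  exact (A.rank_eq_finrank_range_toLin (PiLp.basisFun 2 ℝ (Fin p)) (PiLp.basisFun 2 ℝ (Fin q))).symm

theorem singularValue_eq_zero_of_min_le {p q : ℕ} (A : Matrix (Fin p) (Fin q) ℝ) {j : ℕ}
    (hj : min p q ≤ j) : singularValue A j = 0 := by
  rw [singularValue, LinearMap.singularValues_eq_zero_iff_le_finrank_range,
    finrank_range_toEuclideanLin]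
  have h1 := A.rank_le_height
  have h2 := A.rank_le_width
  omega

theorem matrixTraceNorm_add_le_of_rank_le {p q : ℕ} (A H : Matrix (Fin p) (Fin q) ℝ) {r : ℕ}
    (hA : A.rank ≤ r) :
    matrixTraceNorm A + ∑ j ∈ Finset.Ico r p, singularValue H j ≤
      matrixTraceNorm (A - H) + ∑ j ∈ Finset.range r, singularValue H j := by
  have h1 := A.rank_le_height
  have h2 := A.rank_le_width
  -- `r` may exceed `min p q`, so it is truncated; the singular values beyond `min p q` vanish, and
  -- neither sum over `H` changes.
  have key := LinearMap.sum_singularValues_add_le_of_finrank_range_le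
    (Matrix.toEuclideanLin A) (Matrix.toEuclideanLin H) (m := min p q) (r := min r (min p q))
    (by simp) (by rw [finrank_range_toEuclideanLin]; omega) (min_le_right _ _)
  rw [← map_sub] at key
  have e1 : ∑ j ∈ Finset.Ico (min r (min p q)) (min p q), singularValue H j =
      ∑ j ∈ Finset.Ico r p, singularValue H j := by
    by_cases hr : r ≤ min p q
    · rw [min_eq_left hr]
      refine Finset.sum_subset (Finset.Ico_subset_Ico_right (min_le_left _ _)) fun j hj hj' =>
        singularValue_eq_zero_of_min_le H ?_
      simp only [Finset.mem_Ico] at hj hj'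
      omega
    · rw [min_eq_right (not_le.mp hr).le, Finset.Ico_self, Finset.sum_empty]
      refine (Finset.sum_eq_zero fun j hj => singularValue_eq_zero_of_min_le H ?_).symm
      rw [Finset.mem_Ico] at hj
      omega
  have e2 : ∑ j ∈ Finset.range (min r (min p q)), singularValue H j =
      ∑ j ∈ Finset.range r, singularValue H j := by
    refine Finset.sum_subset (Finset.range_mono (min_le_left _ _)) fun j hj hj' =>
      singularValue_eq_zero_of_min_le H ?_
    rw [Finset.mem_range] at hj hj'
    omega
  rw [← e1, ← e2]
  exact key

theorem Tensor.unfold_sub {M : ℕ} {I : Fin (M + 1) → ℕ} (n : Fin (M + 1)) (X Y : Tensor I) :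
    (X - Y).unfold n = X.unfold n - Y.unfold n := rfl

theorem Tensor.traceNorm_lt_of_sum_singularValue_lt {M : ℕ} {I : Fin (M + 1) → ℕ}
    {r : Fin (M + 1) → ℕ} {X Y : Tensor I} (hX : ∀ i, X.modeRank i ≤ r i)
    (h : (∑ i, ∑ j ∈ Finset.range (r i), singularValue ((X - Y).unfold i) j) <
      ∑ i, ∑ j ∈ Finset.Ico (r i) (I i), singularValue ((X - Y).unfold i) j) :
    X.traceNorm < Y.traceNorm := by
  have key := Finset.sum_le_sum fun i (_ : i ∈ Finset.univ) =>
    matrixTraceNorm_add_le_of_rank_le (X.unfold i) ((X - Y).unfold i) (hX i)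
  simp only [← Tensor.unfold_sub, sub_sub_cancel, Finset.sum_add_distrib] at key
  exact mul_lt_mul_of_pos_left (by linarith) (by positivity)

theorem theorem5 {M m : ℕ} (I : Fin (M + 1) → ℕ) (F : Tensor I →ₗ[ℝ] (Fin m → ℝ))
    (r : Fin (M + 1) → ℕ)
    (hF : ∀ H ∈ LinearMap.ker F, H ≠ 0 →
      (∑ i, ∑ j ∈ Finset.Ico (r i) (I i), singularValue (H.unfold i) j) >
        ∑ i, ∑ j ∈ Finset.range (r i), singularValue (H.unfold i) j) :
    ∀ X₀ : Tensor I, (∀ i, X₀.modeRank i ≤ r i) → ∀ b : Fin m → ℝ, F X₀ = b →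
      IsTraceNormMinimizer F b X₀ ∧ ∀ X : Tensor I, IsTraceNormMinimizer F b X → X = X₀ := by
  intro X₀ hX₀ b hb
  have hlt : ∀ Y : Tensor I, F Y = b → Y ≠ X₀ → X₀.traceNorm < Y.traceNorm := fun Y hY hne =>
    Tensor.traceNorm_lt_of_sum_singularValue_lt hX₀
      (hF (X₀ - Y) (by rw [LinearMap.mem_ker, map_sub, hb, hY, sub_self])
        (sub_ne_zero.mpr hne.symm))
  refine ⟨⟨hb, fun Y hY => ?_⟩, fun X hX => ?_⟩
  · by_cases h : Y = X₀
    · rw [h]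
    · exact (hlt Y hY h).le
  · by_contra h
    exact (hlt X hX.1 h).not_ge (hX.2 X₀ hb)
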